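/- Let $\alpha$ be an irrational real number, and let $(Y_n)_{n\ge 1}$ be a Markov chain on the circle $\mathbb S^1=\mathbb R/\mathbb Z$, defined on some probability space, with transition kernel $$p(x,\cdot)=\tfrac12\,\delta_{x+\alpha}+\tfrac12\,\delta_{x-\alpha}$$ and with $Y_1$ distributed according to the Lebesgue measure on $\mathbb S^1$. Let $\varphi:\mathbb S^1\to\mathbb R$ be a non-constant real trigonometric polynomial, i.e. a real-valued finite linear combination of the functions $x\mapsto e^{2\pi i n x}$, $n\in\mathbb Z$, with $\int_{\mathbb S^1}\varphi(x)\,dx=0$. Then there exists $\sigma>0$, depending only on $\alpha$ and $\varphi$, such that $$\frac{\varphi(Y_1)+\cdots+\varphi(Y_n)}{\sqrt n}\Longrightarrow \mathcal N(0,\sigma^2)\qquad\text{in distribution as } n\to\infty,$$ where $\mathcal N(0,\sigma^2)$ is the normal law with mean $0$ and variance $\sigma^2$. -/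

import Mathlib

open MeasureTheory ProbabilityTheory Filter
open scoped ENNReal

noncomputable section

/-- The transition kernel `p(x, ·) = ½ δ_{x+α} + ½ δ_{x-α}` on the circle `ℝ/ℤ`. -/
def rotationKernel (α : ℝ) : Kernel UnitAddCircle UnitAddCircle where
  toFun x := (2⁻¹ : ℝ≥0∞) • Measure.dirac (x + (α : UnitAddCircle)) +
    (2⁻¹ : ℝ≥0∞) • Measure.dirac (x - (α : UnitAddCircle))
  measurable' := by
    refine Measure.measurable_of_measurable_coe _ fun s hs => ?_
    simp only [Measure.coe_add, Measure.coe_smul, Pi.add_apply, Pi.smul_apply, smul_eq_mul,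
      Measure.dirac_apply' _ hs]
    have h : Measurable (s.indicator (1 : UnitAddCircle → ℝ≥0∞)) := measurable_one.indicator hs
    exact ((h.comp (measurable_id.add_const _)).const_mul _).add
      ((h.comp (measurable_id.sub_const _)).const_mul _)

/-- `Y 0, Y 1, …` is a (time-homogeneous) Markov chain on the probability space `(Ω, P)`, with
transition kernel `p` and initial distribution `ν`: `Y 0` has law `ν`, and the conditional
probability of `Y (n+1) ∈ A` given `Y 0, …, Y n` is `p (Y n, A)`. -/
structure IsMarkovChain {S Ω : Type*} [MeasurableSpace S] [MeasurableSpace Ω]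
    (p : Kernel S S) (ν : Measure S) (P : Measure Ω) (Y : ℕ → Ω → S) : Prop where
  measurable : ∀ n, Measurable (Y n)
  initial : P.map (Y 0) = ν
  markov : ∀ (n : ℕ) (A : Set S), MeasurableSet A →
    P[(Y (n + 1) ⁻¹' A).indicator (fun _ => (1 : ℝ)) |
        ⨆ k ∈ Finset.range (n + 1), MeasurableSpace.comap (Y k) inferInstance]
      =ᵐ[P] fun ω => (p (Y n ω)).real A

/-- A real-valued trigonometric polynomial on the circle `ℝ/ℤ`: a finite linear combination of the
characters `x ↦ exp (2πinx)`, `n ∈ ℤ`, with complex coefficients, all of whose values are real. -/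
def IsTrigPolynomial (φ : UnitAddCircle → ℝ) : Prop :=
  ∃ c : ℤ →₀ ℂ, ∀ x, (φ x : ℂ) = ∑ n ∈ c.support, c n * fourier n x

end

/-! Write P for the Markov operator `rotationAverage`. It multiplies the character of index n by
cos(2πnα), which differs from 1 for n ≠ 0 since α is irrational. Hence ψ - Pψ = φ has a solution ψ
that is again a trigonometric polynomial, with no small divisors since only finitely many
frequencies occur. Set v = ∫ (ψ² - (Pψ)²); this is σ².

The limit is obtained by perturbing P. The operator f ↦ exp(isφ) Pf has the approximate
eigenfunction 1 + isψ + s²b with approximate eigenvalue 1 - s²v/2, up to O(s³), once b solves a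
second Poisson equation that cancels the s² term (`exists_norm_perturbed_sub_le`). Iterating n times
along the chain with s = t/√n (`IsMarkovChain.norm_integral_exp_sum_sub_le`), the characteristic
function is (1 - vt²/(2n))^n + O(n^(-1/2)), which tends to exp(-vt²/2). Lévy's continuity theorem
concludes. -/

/-! ### The averaging operator -/

/-- The Markov operator of `rotationKernel α`, acting on functions. -/
noncomputable def rotationAverage (α : ℝ) (f : UnitAddCircle → ℂ) (x : UnitAddCircle) : ℂ :=
  (f (x + (α : UnitAddCircle)) + f (x - (α : UnitAddCircle))) / 2

lemma integral_rotationKernel (α : ℝ) (f : UnitAddCircle → ℂ)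
    (x : UnitAddCircle) : ∫ y, f y ∂(rotationKernel α x) = rotationAverage α f x := by
  have hi (z : UnitAddCircle) :
      Integrable f ((2⁻¹ : ℝ≥0∞) • Measure.dirac z) :=
    (integrable_dirac (by finiteness)).smul_measure (by simp)
  change ∫ y, f y ∂((2⁻¹ : ℝ≥0∞) • Measure.dirac (x + (α : UnitAddCircle)) +
    (2⁻¹ : ℝ≥0∞) • Measure.dirac (x - (α : UnitAddCircle))) = _
  rw [integral_add_measure (hi _) (hi _), integral_smul_measure, integral_smul_measure,
    integral_dirac, integral_dirac, rotationAverage]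
  simp
  ring

instance (α : ℝ) : IsMarkovKernel (rotationKernel α) where
  isProbabilityMeasure x := ⟨by
    change ((2⁻¹ : ℝ≥0∞) • Measure.dirac (x + (α : UnitAddCircle)) +
      (2⁻¹ : ℝ≥0∞) • Measure.dirac (x - (α : UnitAddCircle))) Set.univ = 1
    simp [ENNReal.inv_two_add_inv_two]⟩

lemma continuous_rotationAverage (α : ℝ) {f : UnitAddCircle → ℂ} (hf : Continuous f) :
    Continuous (rotationAverage α f) := by
  unfold rotationAverage
  fun_prop

/-! ### The Markov property for functions -/

/-- The σ-algebra generated by the first `n + 1` variables of a process. -/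
abbrev pastSigma {S Ω : Type*} [MeasurableSpace S] (Y : ℕ → Ω → S) (n : ℕ) : MeasurableSpace Ω :=
  ⨆ k ∈ Finset.range (n + 1), MeasurableSpace.comap (Y k) inferInstance

lemma measurable_pastSigma {S Ω : Type*} [MeasurableSpace S] (Y : ℕ → Ω → S) {n k : ℕ}
    (h : k ≤ n) : Measurable[pastSigma Y n] (Y k) := by
  rw [measurable_iff_comap_le]
  exact le_iSup₂_of_le k (Finset.mem_range.2 (by omega)) le_rfl

namespace IsMarkovChain

variable {S Ω : Type*} [MeasurableSpace S] [mΩ : MeasurableSpace Ω]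
  {p : Kernel S S} {ν : Measure S} {P : Measure Ω} {Y : ℕ → Ω → S}

lemma pastSigma_le (h : IsMarkovChain p ν P Y) (n : ℕ) : pastSigma Y n ≤ mΩ :=
  iSup₂_le fun k _ => (h.measurable k).comap_le

/-- The Markov property is given for indicators only. As an identity of measures, for each past
event `B`, it can be integrated against any continuous function. -/
lemma map_restrict_succ [IsProbabilityMeasure P] [IsMarkovKernel p] (h : IsMarkovChain p ν P Y)
    (n : ℕ) {B : Set Ω} (hB : MeasurableSet[pastSigma Y n] B) :
    (P.restrict B).map (Y (n + 1)) = ((P.restrict B).map (Y n)).bind p := by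
  have hB' : MeasurableSet B := h.pastSigma_le n B hB
  ext A hA
  have hYA : MeasurableSet (Y (n + 1) ⁻¹' A) := h.measurable _ hA
  have key : ∫ ω in B, (Y (n + 1) ⁻¹' A).indicator (fun _ => (1 : ℝ)) ω ∂P =
      ∫ ω in B, (p (Y n ω)).real A ∂P := by
    rw [← setIntegral_condExp (h.pastSigma_le n) ((integrable_const _).indicator hYA) hB]
    exact setIntegral_congr_ae hB' ((h.markov n A hA).mono fun _ hx _ => hx)
  rw [Measure.map_apply (h.measurable _) hA, Measure.bind_apply hA p.measurable.aemeasurable,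
    lintegral_map (p.measurable_coe hA) (h.measurable n)]
  have hfin : ∫⁻ ω in B, p (Y n ω) A ∂P ≠ ∞ := by
    refine ((setLIntegral_mono measurable_const fun ω _ => prob_le_one).trans_lt
      (b := ∫⁻ ω in B, 1 ∂P) ?_).ne
    simp
  rw [← ENNReal.toReal_eq_toReal_iff' (measure_ne_top _ _) hfin]
  rw [integral_indicator hYA, setIntegral_const, smul_eq_mul, mul_one] at key
  rw [← measureReal_def, key, integral_eq_lintegral_of_nonneg_ae]
  · simp [measureReal_def]
  · exact ae_of_all _ fun _ => measureReal_nonneg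
  · exact ((p.measurable_coe hA).ennreal_toReal.comp (h.measurable n)).aestronglyMeasurable

end IsMarkovChain

/-- The Markov property tested against bounded past-measurable weights. -/
lemma IsMarkovChain.integral_mul_succ {Ω : Type*} [mΩ : MeasurableSpace Ω] {α : ℝ}
    {ν : Measure UnitAddCircle} {P : Measure Ω} [IsProbabilityMeasure P]
    {Y : ℕ → Ω → UnitAddCircle} (h : IsMarkovChain (rotationKernel α) ν P Y) (n : ℕ)
    {G : Ω → ℂ} (hG : Measurable[pastSigma Y n] G) {C : ℝ} (hGC : ∀ ω, ‖G ω‖ ≤ C)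
    (f : C(UnitAddCircle, ℂ)) :
    ∫ ω, G ω * f (Y (n + 1) ω) ∂P = ∫ ω, G ω * rotationAverage α f (Y n ω) ∂P := by
  have hm := h.pastSigma_le n
  have hfi (k : ℕ) : Integrable (fun ω => f (Y k ω)) P :=
    .of_bound (f.continuous.measurable.comp (h.measurable k)).aestronglyMeasurable ‖f‖
      (ae_of_all _ fun ω => f.norm_coe_le_norm _)
  have hA := continuous_rotationAverage α f.continuous
  have hAb (x) : ‖rotationAverage α f x‖ ≤ ‖f‖ := by
    have h1 := norm_add_le (f (x + (α : UnitAddCircle))) (f (x - (α : UnitAddCircle)))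
    have h2 := f.norm_coe_le_norm (x + (α : UnitAddCircle))
    have h3 := f.norm_coe_le_norm (x - (α : UnitAddCircle))
    rw [rotationAverage, norm_div]
    simp only [Complex.norm_ofNat]
    linarith
  have hAi : Integrable (fun ω => rotationAverage α f (Y n ω)) P :=
    .of_bound (hA.measurable.comp (h.measurable n)).aestronglyMeasurable ‖f‖
      (ae_of_all _ fun ω => hAb _)
  have hce : (fun ω => rotationAverage α f (Y n ω)) =ᵐ[P]
      P[fun ω => f (Y (n + 1) ω) | pastSigma Y n] := by
    refine ae_eq_condExp_of_forall_setIntegral_eq hm (hfi _) (fun _ _ _ => hAi.integrableOn)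
      (fun B hB _ => ?_)
      (hA.measurable.comp (measurable_pastSigma Y le_rfl)).stronglyMeasurable.aestronglyMeasurable
    have e1 : ∫ ω in B, f (Y (n + 1) ω) ∂P = ∫ y, f y ∂((P.restrict B).map (Y (n + 1))) :=
      (integral_map (h.measurable _).aemeasurable f.continuous.aestronglyMeasurable).symm
    rw [e1, h.map_restrict_succ n hB, Measure.comp_eq_comp_const_apply, Kernel.integral_comp, Kernel.const_apply]
    · simp_rw [integral_rotationKernel α]
      exact (integral_map (h.measurable _).aemeasurable hA.aestronglyMeasurable).symm
    · exact .of_bound f.continuous.aestronglyMeasurable ‖f‖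
        (ae_of_all _ fun ω => f.norm_coe_le_norm _)
  have hGf : Integrable (fun ω => G ω * f (Y (n + 1) ω)) P :=
    (hfi (n + 1)).bdd_mul (hG.mono hm le_rfl).aestronglyMeasurable (ae_of_all _ hGC)
  rw [← integral_condExp hm]
  refine integral_congr_ae ?_
  filter_upwards [condExp_bilin_of_stronglyMeasurable_left (ContinuousLinearMap.mul ℝ ℂ)
    hG.stronglyMeasurable hGf (hfi (n + 1)), hce] with ω h1 h2
  simp only [ContinuousLinearMap.mul_apply'] at h1
  rw [h1, h2]

/-! ### Fourier analysis and the Poisson equation -/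

lemma fourier_apply_add (n : ℤ) (x y : UnitAddCircle) :
    fourier n (x + y) = fourier n x * fourier n y := by
  simp only [fourier_apply, smul_add, AddCircle.toCircle_add, Circle.coe_mul]

lemma integral_fourier_eq_zero {n : ℤ} (hn : n ≠ 0) :
    ∫ x : UnitAddCircle, fourier n x = 0 :=
  integral_eq_zero_of_add_right_eq_neg (fourier_add_half_inv_index hn one_pos)

lemma rotationAverage_fourier (α : ℝ) (n : ℤ) (x : UnitAddCircle) :
    rotationAverage α (fourier n) x = Complex.cos (2 * Real.pi * n * α) * fourier n x := by
  have h1 : fourier n (α : UnitAddCircle) = Complex.exp (2 * Real.pi * n * α * Complex.I) := by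
    rw [fourier_coe_apply]
    congr 1
    push_cast
    ring
  have h2 : fourier n (-(α : UnitAddCircle)) =
      Complex.exp (-(2 * Real.pi * n * α) * Complex.I) := by
    rw [← AddCircle.coe_neg, fourier_coe_apply]
    congr 1
    push_cast
    ring
  rw [rotationAverage, sub_eq_add_neg, fourier_apply_add, fourier_apply_add, h1, h2, Complex.cos]
  ring

lemma cos_two_pi_int_mul_irrational_ne_one {α : ℝ} (hα : Irrational α) {n : ℤ} (hn : n ≠ 0) :
    Complex.cos (2 * Real.pi * n * α) ≠ 1 := by
  intro h
  have h' : Real.cos (2 * Real.pi * n * α) = 1 := by exact_mod_cast h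
  obtain ⟨k, hk⟩ := (Real.cos_eq_one_iff _).1 h'
  have : (n : ℝ) * α = k := by
    have hp : (2 * Real.pi) ≠ 0 := by positivity
    apply mul_left_cancel₀ hp
    linarith
  exact (hα.intCast_mul hn).ne_int k this

/-- Solvability of the Poisson equation for trigonometric polynomials. -/
lemma exists_sub_rotationAverage_eq {α : ℝ} (hα : Irrational α) {f : C(UnitAddCircle, ℂ)}
    (hf : f ∈ fourierSubalgebra) :
    ∃ g ∈ fourierSubalgebra, ∀ x, g x - rotationAverage α g x = f x - ∫ y, f y := by
  have hf' : f ∈ Submodule.span ℂ (Set.range (fourier (T := 1))) := by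
    rw [← fourierSubalgebra_coe]
    exact hf
  have hint (f : C(UnitAddCircle, ℂ)) : Integrable f :=
    .of_bound f.continuous.aestronglyMeasurable ‖f‖ (ae_of_all _ f.norm_coe_le_norm)
  clear hf
  induction hf' using Submodule.span_induction with
  | mem f h =>
    obtain ⟨n, rfl⟩ := h
    by_cases hn : n = 0
    · subst hn
      refine ⟨0, zero_mem _, fun x => ?_⟩
      simp [rotationAverage, measureReal_def]
    -- On this frequency 1 - P is multiplication by 1 - cos(2πnα), which is nonzero.
    · refine ⟨(1 - Complex.cos (2 * Real.pi * n * α))⁻¹ • fourier n,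
        SMulMemClass.smul_mem _ (Algebra.subset_adjoin ⟨n, rfl⟩), fun x => ?_⟩
      have hne := sub_ne_zero.2 (cos_two_pi_int_mul_irrational_ne_one hα hn).symm
      have h := rotationAverage_fourier α n x
      rw [integral_fourier_eq_zero hn]
      simp only [rotationAverage, ContinuousMap.smul_apply, smul_eq_mul] at h ⊢
      rw [← mul_add, mul_div_assoc, h]
      field_simp
      ring
  | zero => exact ⟨0, zero_mem _, fun x => by simp [rotationAverage]⟩
  | add f₁ f₂ _ _ h₁ h₂ =>
    obtain ⟨g₁, hg₁, e₁⟩ := h₁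
    obtain ⟨g₂, hg₂, e₂⟩ := h₂
    refine ⟨g₁ + g₂, add_mem hg₁ hg₂, fun x => ?_⟩
    have e₁ := e₁ x
    have e₂ := e₂ x
    simp only [rotationAverage, ContinuousMap.add_apply] at e₁ e₂ ⊢
    rw [integral_add (hint f₁) (hint f₂)]
    linear_combination e₁ + e₂
  | smul c f _ h =>
    obtain ⟨g, hg, e⟩ := h
    refine ⟨c • g, SMulMemClass.smul_mem _ hg, fun x => ?_⟩
    have e := e x
    simp only [rotationAverage, ContinuousMap.smul_apply, smul_eq_mul] at e ⊢
    rw [integral_const_mul]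
    linear_combination c * e

/-- Composition of a real continuous function with the embedding `ℝ → ℂ`. -/
noncomputable def complexify (ψ : C(UnitAddCircle, ℝ)) : C(UnitAddCircle, ℂ) :=
  ⟨fun x => (ψ x : ℂ), by fun_prop⟩

@[simp]
lemma complexify_apply (ψ : C(UnitAddCircle, ℝ)) (x : UnitAddCircle) :
    complexify ψ x = (ψ x : ℂ) := rfl

lemma IsTrigPolynomial.exists_complexify {φ : UnitAddCircle → ℝ} (hφ : IsTrigPolynomial φ) :
    ∃ Φ : C(UnitAddCircle, ℝ), complexify Φ ∈ fourierSubalgebra ∧ ⇑Φ = φ := by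
  obtain ⟨c, hc⟩ := hφ
  let F : C(UnitAddCircle, ℂ) := ∑ n ∈ c.support, c n • fourier n
  have hF (x) : (φ x : ℂ) = F x := by simp [F, hc, ContinuousMap.sum_apply]
  have hcont : Continuous φ := by
    have : φ = fun x => (F x).re := by
      ext x
      rw [← hF, Complex.ofReal_re]
    rw [this]
    fun_prop
  refine ⟨⟨φ, hcont⟩, ?_, rfl⟩
  have : complexify ⟨φ, hcont⟩ = F := ContinuousMap.ext hF
  rw [this]
  exact sum_mem fun n _ => SMulMemClass.smul_mem _ (Algebra.subset_adjoin ⟨n, rfl⟩)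

/-- P commutes with taking real parts, and the trigonometric polynomials are closed under
conjugation, so the real part of a complex solution serves. -/
lemma exists_real_sub_rotationAverage_eq {α : ℝ} (hα : Irrational α) {φ : C(UnitAddCircle, ℝ)}
    (hφ : complexify φ ∈ fourierSubalgebra) (hmean : ∫ x, φ x = 0) :
    ∃ ψ : C(UnitAddCircle, ℝ), complexify ψ ∈ fourierSubalgebra ∧
      ∀ x, ψ x - (ψ (x + (α : UnitAddCircle)) + ψ (x - (α : UnitAddCircle))) / 2 = φ x := by
  obtain ⟨g, hg, e⟩ := exists_sub_rotationAverage_eq hα hφ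
  refine ⟨⟨fun x => (g x).re, by fun_prop⟩, ?_, fun x => ?_⟩
  · have : complexify ⟨fun x => (g x).re, by fun_prop⟩ = (2⁻¹ : ℂ) • (g + star g) := by
      ext x
      simp [Complex.re_eq_add_conj]
      ring
    rw [this]
    exact SMulMemClass.smul_mem _ (add_mem hg (star_mem hg))
  · have h0 : ∫ y, complexify φ y = 0 := by
      simp only [complexify_apply]
      rw [integral_complex_ofReal, hmean, Complex.ofReal_zero]
    have := congrArg Complex.re (e x)
    rw [h0] at this
    simpa [rotationAverage] using this

/-! ### Positivity of the variance -/

/-- A continuous function on the circle invariant under an irrational rotation is constant. -/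
lemma eq_of_forall_add_irrational_eq {β : ℝ} (hβ : Irrational β) {ψ : UnitAddCircle → ℝ}
    (hψ : Continuous ψ) (h : ∀ x, ψ (x + (β : UnitAddCircle)) = ψ x) (x : UnitAddCircle) :
    ψ x = ψ 0 := by
  have hd : DenseRange (· • (β : UnitAddCircle) : ℤ → UnitAddCircle) :=
    AddCircle.denseRange_zsmul_coe_iff.2 (by simpa using hβ)
  have hz (n : ℤ) : ψ (n • (β : UnitAddCircle)) = ψ 0 := by
    induction n using Int.induction_on with
    | zero => simp
    | succ i ih => rw [add_zsmul, one_zsmul, h, ih]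
    | pred i ih => rw [← ih, ← h, sub_zsmul, one_zsmul]; simp
  exact congrFun (hd.equalizer hψ continuous_const (funext hz)) x

/-- The asymptotic variance `∫ (ψ² - (Pψ)²)` is positive. -/
lemma integral_sq_sub_sq_pos {α : ℝ} (hα : Irrational α) {φ ψ : C(UnitAddCircle, ℝ)}
    (hφ : ¬ ∃ c : ℝ, ∀ x, φ x = c)
    (h : ∀ x, ψ x - (ψ (x + (α : UnitAddCircle)) + ψ (x - (α : UnitAddCircle))) / 2 = φ x) :
    0 < ∫ x, (ψ x ^ 2 - (ψ x - φ x) ^ 2) := by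
  have hint {f : UnitAddCircle → ℝ} (hf : Continuous f) : Integrable f := by
    let F : C(UnitAddCircle, ℝ) := ⟨f, hf⟩
    exact .of_bound hf.aestronglyMeasurable ‖F‖ (ae_of_all _ F.norm_coe_le_norm)
  let a : UnitAddCircle := α
  let d : UnitAddCircle → ℝ := fun x => (ψ (x + a) - ψ (x - a)) / 2
  have hd : Continuous d := by fun_prop
  have e : ∫ x, (ψ x ^ 2 - (ψ x - φ x) ^ 2) = ∫ x, d x ^ 2 := by
    -- Since ψ - φ = Pψ, this is (p² + q²)/2 - ((p + q)/2)² = ((p - q)/2)² at the two neighbours;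
    -- the remaining terms cancel under the integral by translation invariance.
    have e1 : (fun x => ψ x ^ 2 - (ψ x - φ x) ^ 2) = fun x =>
        d x ^ 2 + (ψ x ^ 2 - (ψ (x + a) ^ 2 / 2 + ψ (x - a) ^ 2 / 2)) := by
      ext x
      rw [← h x]
      simp only [d, a]
      ring
    have e2 : ∫ x, ψ (x + a) ^ 2 = ∫ x, ψ x ^ 2 := integral_add_right_eq_self (fun x => ψ x ^ 2) a
    have e3 : ∫ x, ψ (x - a) ^ 2 = ∫ x, ψ x ^ 2 := integral_sub_right_eq_self (fun x => ψ x ^ 2) a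
    rw [e1, integral_add (hint (by fun_prop)) (hint (by fun_prop)),
      integral_sub (hint (by fun_prop)) (hint (by fun_prop)),
      integral_add (hint (by fun_prop)) (hint (by fun_prop)), integral_div, integral_div, e2, e3]
    ring
  rw [e]
  by_cases hz : ∃ x, d x ≠ 0
  · obtain ⟨x, hx⟩ := hz
    exact Continuous.integral_pos_of_hasCompactSupport_nonneg_nonzero (x := x) (by fun_prop)
      (HasCompactSupport.of_compactSpace _) (fun _ => sq_nonneg _) (pow_ne_zero _ hx)
  · push Not at hz
    -- If d vanishes identically, ψ is invariant under rotation by 2α, hence constant, which forces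
    -- φ = 0.
    have hinv (x) : ψ (x + ((2 * α : ℝ) : UnitAddCircle)) = ψ x := by
      have := hz (x + a)
      have h2 : ((2 * α : ℝ) : UnitAddCircle) = a + a := by
        rw [two_mul, AddCircle.coe_add]
      simp only [d, add_sub_cancel_right] at this
      rw [h2, ← add_assoc]
      linarith
    have hc := eq_of_forall_add_irrational_eq
      (by simpa using hα.natCast_mul two_ne_zero) ψ.continuous hinv
    refine absurd ⟨0, fun x => ?_⟩ hφ
    rw [← h x, hc x, hc (x + _), hc (x - _)]
    ring

/-! ### The perturbed operator -/

/-- The approximate eigenfunction `1 + isψ + s²b` of the perturbed operator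
`f ↦ exp(isφ) Pf`. -/
noncomputable def approxEigenfunction (ψ : C(UnitAddCircle, ℝ)) (b : C(UnitAddCircle, ℂ)) (s : ℝ) :
    C(UnitAddCircle, ℂ) :=
  1 + ((s : ℂ) * Complex.I) • complexify ψ + ((s : ℂ) ^ 2) • b

lemma approxEigenfunction_apply (ψ : C(UnitAddCircle, ℝ)) (b : C(UnitAddCircle, ℂ)) (s : ℝ)
    (x : UnitAddCircle) :
    approxEigenfunction ψ b s x = 1 + s * Complex.I * ψ x + (s : ℂ) ^ 2 * b x := by
  simp [approxEigenfunction]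

lemma norm_approxEigenfunction_sub_one_le (ψ : C(UnitAddCircle, ℝ)) (b : C(UnitAddCircle, ℂ))
    {s : ℝ} (hs : |s| ≤ 1) (x : UnitAddCircle) :
    ‖approxEigenfunction ψ b s x - 1‖ ≤ (‖ψ‖ + ‖b‖) * |s| := by
  have e : approxEigenfunction ψ b s x - 1 =
      s * (Complex.I * (ψ x : ℂ) + s * b x) := by
    rw [approxEigenfunction_apply]
    ring
  have hψ : ‖(Complex.I * (ψ x : ℂ) + s * b x)‖ ≤ ‖ψ‖ + ‖b‖ := by
    refine (norm_add_le _ _).trans (add_le_add ?_ ?_)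
    · simpa using ψ.norm_coe_le_norm x
    · rw [norm_mul, Complex.norm_real, Real.norm_eq_abs]
      exact (mul_le_of_le_one_left (norm_nonneg _) hs).trans (b.norm_coe_le_norm x)
  rw [e, norm_mul, Complex.norm_real, Real.norm_eq_abs, mul_comm]
  gcongr

lemma norm_exp_mul_I_sub_taylor_le (y : ℝ) :
    ‖Complex.exp (y * Complex.I) - (1 + y * Complex.I - (y : ℂ) ^ 2 / 2)‖
      ≤ |y| ^ 3 * Real.exp |y| := by
  have h := Complex.norm_exp_sub_sum_le_norm_mul_exp (y * Complex.I) 3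
  simp only [Finset.sum_range_succ, Finset.sum_range_zero, norm_mul, Complex.norm_I, mul_one,
    Complex.norm_real, Real.norm_eq_abs] at h
  convert h using 3
  simp [Nat.factorial, mul_pow]
  ring

lemma exists_bound_of_continuous {f : UnitAddCircle → ℂ} (hf : Continuous f) :
    ∃ K : ℝ, 0 ≤ K ∧ ∀ x, ‖f x‖ ≤ K :=
  ⟨‖(⟨f, hf⟩ : C(UnitAddCircle, ℂ))‖, norm_nonneg _,
    ContinuousMap.norm_coe_le_norm (⟨f, hf⟩ : C(UnitAddCircle, ℂ))⟩

/-- `approxEigenfunction` is an eigenfunction of the perturbed operator up to third order. -/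
lemma exists_norm_perturbed_sub_le {α v : ℝ} {φ ψ : C(UnitAddCircle, ℝ)}
    {b : C(UnitAddCircle, ℂ)}
    (hψ : ∀ x, ψ x - (ψ (x + (α : UnitAddCircle)) + ψ (x - (α : UnitAddCircle))) / 2 = φ x)
    (hb : ∀ x, b x - rotationAverage α b x =
      ((v - (ψ x ^ 2 - (ψ x - φ x) ^ 2) : ℝ) : ℂ) / 2) :
    ∃ C : ℝ, ∀ s : ℝ, |s| ≤ 1 → ∀ x,
      ‖Complex.exp ((s * φ x : ℝ) * Complex.I) * rotationAverage α (approxEigenfunction ψ b s) x -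
        (1 - (s : ℂ) ^ 2 * v / 2) * approxEigenfunction ψ b s x‖ ≤ C * |s| ^ 3 := by
  let c : UnitAddCircle → ℂ := rotationAverage α b
  have hc : Continuous c := continuous_rotationAverage α b.continuous
  -- `K₃` and `K₄` bound the coefficients of s³ and s⁴ left after replacing the exponential by its
  -- quadratic Taylor polynomial.
  obtain ⟨K₃, hK₃, h₃⟩ := exists_bound_of_continuous
    (f := fun x => Complex.I * φ x * c x - Complex.I * (φ x : ℂ) ^ 2 / 2 * (ψ x - φ x) +
      Complex.I * v / 2 * ψ x) (by fun_prop)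
  obtain ⟨K₄, hK₄, h₄⟩ := exists_bound_of_continuous
    (f := fun x => -(φ x : ℂ) ^ 2 / 2 * c x + v / 2 * b x) (by fun_prop)
  refine ⟨‖φ‖ ^ 3 * Real.exp ‖φ‖ * (1 + (‖ψ‖ + ‖b‖)) + (K₃ + K₄), fun s hs x => ?_⟩
  have hu (y) : ‖approxEigenfunction ψ b s y‖ ≤ 1 + (‖ψ‖ + ‖b‖) := by
    have h1 := norm_approxEigenfunction_sub_one_le ψ b hs y
    have h2 : (‖ψ‖ + ‖b‖) * |s| ≤ ‖ψ‖ + ‖b‖ := mul_le_of_le_one_right (by positivity) hs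
    have h3 := norm_le_norm_add_norm_sub' (approxEigenfunction ψ b s y) 1
    rw [norm_one] at h3
    linarith
  have hPu : ‖rotationAverage α (approxEigenfunction ψ b s) x‖ ≤ 1 + (‖ψ‖ + ‖b‖) := by
    rw [rotationAverage, norm_div, Complex.norm_ofNat]
    have h1 := norm_add_le (approxEigenfunction ψ b s (x + (α : UnitAddCircle)))
      (approxEigenfunction ψ b s (x - (α : UnitAddCircle)))
    have h2 := hu (x + (α : UnitAddCircle))
    have h3 := hu (x - (α : UnitAddCircle))
    linarith
  have hψc : (ψ x : ℂ) - (ψ (x + (α : UnitAddCircle)) + ψ (x - (α : UnitAddCircle))) / 2 =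
      φ x := by
    exact_mod_cast hψ x
  have ePu : rotationAverage α (approxEigenfunction ψ b s) x =
      1 + s * Complex.I * (ψ x - φ x) + (s : ℂ) ^ 2 * c x := by
    simp only [rotationAverage, approxEigenfunction_apply, c]
    linear_combination (-s * Complex.I) * hψc
  have hbx : b x = c x + ((v - (ψ x ^ 2 - (ψ x - φ x) ^ 2) : ℝ) : ℂ) / 2 := by
    rw [← hb x]
    ring
  set R : ℂ := Complex.exp ((s * φ x : ℝ) * Complex.I) -
    (1 + (s * φ x : ℝ) * Complex.I - ((s * φ x : ℝ) : ℂ) ^ 2 / 2) with hR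
  have hRn : ‖R‖ ≤ ‖φ‖ ^ 3 * Real.exp ‖φ‖ * |s| ^ 3 := by
    have hφx : |φ x| ≤ ‖φ‖ := φ.norm_coe_le_norm x
    refine (norm_exp_mul_I_sub_taylor_le _).trans ?_
    rw [abs_mul, mul_pow]
    have : |s| * |φ x| ≤ ‖φ‖ := (mul_le_of_le_one_left (abs_nonneg _) hs).trans hφx
    calc |s| ^ 3 * |φ x| ^ 3 * Real.exp (|s| * |φ x|)
        ≤ |s| ^ 3 * ‖φ‖ ^ 3 * Real.exp ‖φ‖ := by gcongr
      _ = _ := by ring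
  have key : Complex.exp ((s * φ x : ℝ) * Complex.I) *
        rotationAverage α (approxEigenfunction ψ b s) x -
        (1 - (s : ℂ) ^ 2 * v / 2) * approxEigenfunction ψ b s x =
      R * rotationAverage α (approxEigenfunction ψ b s) x +
      (s : ℂ) ^ 3 * ((Complex.I * φ x * c x - Complex.I * (φ x : ℂ) ^ 2 / 2 * (ψ x - φ x) +
        Complex.I * v / 2 * ψ x) + s * (-(φ x : ℂ) ^ 2 / 2 * c x + v / 2 * b x)) := by
    rw [hR, ePu, approxEigenfunction_apply]
    push_cast at hbx ⊢
    -- The orders 0 and 1 in s cancel identically; order 2 is the equation for `b`.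
    linear_combination (-(s : ℂ) ^ 2) * hbx + (s : ℂ) ^ 2 * φ x * (ψ x - φ x) * Complex.I_sq
  rw [key, add_mul]
  refine (norm_add_le _ _).trans (add_le_add ?_ ?_)
  · rw [norm_mul, mul_right_comm]
    gcongr
  · rw [norm_mul, norm_pow, Complex.norm_real, Real.norm_eq_abs, mul_comm]
    gcongr
    refine (norm_add_le _ _).trans (add_le_add (h₃ x) ?_)
    rw [norm_mul, Complex.norm_real, Real.norm_eq_abs]
    exact (mul_le_of_le_one_left (norm_nonneg _) hs).trans (h₄ x)

/-! ### Characteristic functions of the partial sums -/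

section CharFun

variable {Ω : Type*} [mΩ : MeasurableSpace Ω] {α : ℝ} {ν : Measure UnitAddCircle} {P : Measure Ω}
  [IsProbabilityMeasure P] {Y : ℕ → Ω → UnitAddCircle}

lemma norm_integral_exp_mul_le (X : Ω → ℝ) {f : Ω → ℂ} {C : ℝ} (hf : ∀ ω, ‖f ω‖ ≤ C) :
    ‖∫ ω, Complex.exp (X ω * Complex.I) * f ω ∂P‖ ≤ C := by
  refine (norm_integral_le_of_norm_le_const (C := C) (ae_of_all _ fun ω => ?_)).trans (by simp)
  rw [norm_mul, Complex.norm_exp_ofReal_mul_I, one_mul]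
  exact hf ω

/-- Comparison of the characteristic function of the partial sums with a power of the approximate
eigenvalue. -/
lemma IsMarkovChain.norm_integral_exp_sum_sub_le (h : IsMarkovChain (rotationKernel α) ν P Y)
    (φ : C(UnitAddCircle, ℝ)) (u : C(UnitAddCircle, ℂ)) {s : ℝ} {l : ℂ} {ε δ : ℝ} (hl : ‖l‖ ≤ 1)
    (hu : ∀ x, ‖u x - 1‖ ≤ δ)
    (hε : ∀ x, ‖Complex.exp ((s * φ x : ℝ) * Complex.I) * rotationAverage α u x - l * u x‖ ≤ ε)
    (n : ℕ) :
    ‖∫ ω, Complex.exp ((s * ∑ k ∈ Finset.range n, φ (Y k ω) : ℝ) * Complex.I) ∂P - l ^ n‖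
      ≤ n * ε + 2 * δ := by
  have hmS (n : ℕ) : Measurable fun ω => s * ∑ k ∈ Finset.range n, φ (Y k ω) := by
    refine measurable_const.mul (Finset.measurable_fun_sum _ fun k _ => ?_)
    exact φ.continuous.measurable.comp (h.measurable k)
  have hint (n : ℕ) {f : UnitAddCircle → ℂ} (hf : Continuous f) : Integrable (fun ω =>
      Complex.exp ((s * ∑ k ∈ Finset.range n, φ (Y k ω) : ℝ) * Complex.I) * f (Y n ω)) P := by
    obtain ⟨K, -, hK⟩ := exists_bound_of_continuous hf
    refine .of_bound ?_ K (ae_of_all _ fun ω => ?_)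
    · refine Measurable.aestronglyMeasurable (.mul ?_ (hf.measurable.comp (h.measurable n)))
      exact Complex.measurable_exp.comp
        ((Complex.measurable_ofReal.comp (hmS n)).mul_const Complex.I)
    · rw [norm_mul, Complex.norm_exp_ofReal_mul_I, one_mul]
      exact hK _
  let I (n : ℕ) (f : UnitAddCircle → ℂ) : ℂ :=
    ∫ ω, Complex.exp ((s * ∑ k ∈ Finset.range n, φ (Y k ω) : ℝ) * Complex.I) * f (Y n ω) ∂P
  -- Conditioning on the past up to time n turns `u (Y (n + 1))` into Pu at `Y n`; the last factor
  -- exp(isφ) then completes the perturbed operator.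
  have hPu := continuous_rotationAverage α u.continuous
  have hstep (n : ℕ) : ‖I (n + 1) u - l * I n u‖ ≤ ε := by
    have e1 : I (n + 1) u = ∫ ω, Complex.exp ((s * ∑ k ∈ Finset.range n, φ (Y k ω) : ℝ) *
        Complex.I) * (Complex.exp ((s * φ (Y n ω) : ℝ) * Complex.I) *
          rotationAverage α u (Y n ω)) ∂P := by
      have hG : Measurable[pastSigma Y n] fun ω =>
          Complex.exp ((s * ∑ k ∈ Finset.range (n + 1), φ (Y k ω) : ℝ) * Complex.I) := by
        refine Complex.measurable_exp.comp (Measurable.mul_const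
          (Complex.measurable_ofReal.comp (Measurable.const_mul ?_ _)) _)
        refine Finset.measurable_fun_sum _ fun k hk => ?_
        exact φ.continuous.measurable.comp
          (measurable_pastSigma Y (Nat.lt_succ_iff.1 (Finset.mem_range.1 hk)))
      refine (h.integral_mul_succ n hG (C := 1)
        (fun ω => (Complex.norm_exp_ofReal_mul_I _).le) u).trans (integral_congr_ae (ae_of_all _ ?_))
      intro ω
      simp only
      rw [← mul_assoc, ← Complex.exp_add, Finset.sum_range_succ]
      push_cast
      ring_nf
    have e2 : I (n + 1) u - l * I n u =
        ∫ ω, Complex.exp ((s * ∑ k ∈ Finset.range n, φ (Y k ω) : ℝ) * Complex.I) *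
          (Complex.exp ((s * φ (Y n ω) : ℝ) * Complex.I) * rotationAverage α u (Y n ω) -
            l * u (Y n ω)) ∂P := by
      rw [e1, ← integral_const_mul, ← integral_sub]
      · congr 1
        ext ω
        ring
      · exact hint n (f := fun x => Complex.exp ((s * φ x : ℝ) * Complex.I) *
          rotationAverage α u x) (by fun_prop)
      · exact (hint n u.continuous).const_mul l
    rw [e2]
    exact norm_integral_exp_mul_le _ fun ω => hε _
  have hiter (n : ℕ) : ‖I n u - l ^ n * I 0 u‖ ≤ n * ε := by
    induction n with
    | zero => simp
    | succ n ih =>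
      have e : I (n + 1) u - l ^ (n + 1) * I 0 u =
          (I (n + 1) u - l * I n u) + l * (I n u - l ^ n * I 0 u) := by ring
      rw [e]
      refine (norm_add_le _ _).trans ?_
      rw [norm_mul]
      have := mul_le_of_le_one_left (norm_nonneg (I n u - l ^ n * I 0 u)) hl
      have := hstep n
      push_cast
      linarith
  have hone (n : ℕ) : ‖I n u - I n 1‖ ≤ δ := by
    have e : I n u - I n 1 =
        ∫ ω, Complex.exp ((s * ∑ k ∈ Finset.range n, φ (Y k ω) : ℝ) * Complex.I) *
          (u (Y n ω) - 1) ∂P := by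
      rw [← integral_sub (hint n u.continuous) (hint n continuous_one)]
      congr 1
      ext ω
      simp only [Pi.one_apply]
      ring
    rw [e]
    exact norm_integral_exp_mul_le _ fun ω => hu _
  have h0 : I 0 1 = 1 := by simp [I]
  have hgoal : ∫ ω, Complex.exp ((s * ∑ k ∈ Finset.range n, φ (Y k ω) : ℝ) * Complex.I) ∂P =
      I n 1 := by simp [I]
  -- Replacing `u` by 1 at times n and 0 costs δ each; the n iterations cost ε each.
  have e : I n 1 - l ^ n = (I n u - l ^ n * I 0 u) + -(I n u - I n 1) +
      l ^ n * (I 0 u - I 0 1) := by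
    rw [h0]
    ring
  rw [hgoal, e]
  refine (norm_add₃_le).trans ?_
  have h1 : ‖l ^ n * (I 0 u - I 0 1)‖ ≤ ‖I 0 u - I 0 1‖ := by
    rw [norm_mul, norm_pow]
    exact mul_le_of_le_one_left (norm_nonneg _) (pow_le_one₀ (norm_nonneg _) hl)
  rw [norm_neg]
  linarith [hiter n, hone n, hone 0]

lemma IsMarkovChain.tendsto_integral_exp_sum_div_sqrt (h : IsMarkovChain (rotationKernel α) ν P Y)
    {v : ℝ} (hv : 0 < v) {φ ψ : C(UnitAddCircle, ℝ)} {b : C(UnitAddCircle, ℂ)}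
    (hψ : ∀ x, ψ x - (ψ (x + (α : UnitAddCircle)) + ψ (x - (α : UnitAddCircle))) / 2 = φ x)
    (hb : ∀ x, b x - rotationAverage α b x =
      ((v - (ψ x ^ 2 - (ψ x - φ x) ^ 2) : ℝ) : ℂ) / 2) (t : ℝ) :
    Tendsto (fun n : ℕ => ∫ ω, Complex.exp
      ((t / √(n : ℝ) * ∑ k ∈ Finset.range n, φ (Y k ω) : ℝ) * Complex.I) ∂P) atTop
      (nhds (Complex.exp (-(v * t ^ 2 / 2)))) := by
  obtain ⟨C, hC⟩ := exists_norm_perturbed_sub_le hψ hb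
  have hs : Tendsto (fun n : ℕ => t / √(n : ℝ)) atTop (nhds 0) :=
    tendsto_const_nhds.div_atTop (Real.tendsto_sqrt_atTop.comp tendsto_natCast_atTop_atTop)
  have hpow : Tendsto (fun n : ℕ => (1 + (-(v * t ^ 2 / 2) : ℂ) / n) ^ n) atTop
      (nhds (Complex.exp (-(v * t ^ 2 / 2)))) := Complex.tendsto_one_add_div_pow_exp _
  have hsq (n : ℕ) : (t / √(n : ℝ)) ^ 2 = t ^ 2 / n := by
    rw [div_pow, Real.sq_sqrt (Nat.cast_nonneg n)]
  have hbound : ∀ᶠ n : ℕ in atTop,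
      ‖(∫ ω, Complex.exp ((t / √(n : ℝ) * ∑ k ∈ Finset.range n, φ (Y k ω) : ℝ) * Complex.I) ∂P) -
        (1 + (-(v * t ^ 2 / 2) : ℂ) / n) ^ n‖ ≤
        (C * t ^ 2 + 2 * (‖ψ‖ + ‖b‖)) * |t / √(n : ℝ)| := by
    have hsabs : Tendsto (fun n : ℕ => |t / √(n : ℝ)|) atTop (nhds 0) := by simpa using hs.abs
    have hsv : Tendsto (fun n : ℕ => (t / √(n : ℝ)) ^ 2 * v / 2) atTop (nhds 0) := by
      simpa using ((hs.pow 2).mul_const v).div_const 2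
    filter_upwards [hsabs.eventually_le_const one_pos, hsv.eventually_le_const one_pos,
      eventually_gt_atTop 0] with n h1 h2 hn
    have hn' : (n : ℝ) ≠ 0 := by positivity
    have hnc : (n : ℂ) ≠ 0 := by exact_mod_cast hn.ne'
    have hsqn := hsq n
    have hlv : (1 : ℂ) - ((t / √(n : ℝ) : ℝ) : ℂ) ^ 2 * v / 2 =
        1 + (-(v * t ^ 2 / 2) : ℂ) / n := by
      rw [← Complex.ofReal_pow, hsqn]
      push_cast
      field_simp
      ring
    have hl : ‖(1 : ℂ) - ((t / √(n : ℝ) : ℝ) : ℂ) ^ 2 * v / 2‖ ≤ 1 := by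
      have e : (1 : ℂ) - ((t / √(n : ℝ) : ℝ) : ℂ) ^ 2 * v / 2 =
          ((1 - (t / √(n : ℝ)) ^ 2 * v / 2 : ℝ) : ℂ) := by push_cast; ring
      have h0 : 0 ≤ (t / √(n : ℝ)) ^ 2 * v / 2 := by positivity
      rw [e, Complex.norm_real, Real.norm_eq_abs, abs_le]
      constructor <;> linarith
    have := h.norm_integral_exp_sum_sub_le φ (approxEigenfunction ψ b (t / √(n : ℝ))) hl
      (norm_approxEigenfunction_sub_one_le ψ b h1) (hC _ h1) n
    rw [hlv] at this
    refine this.trans_eq ?_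
    -- With s = t/√n one has n|s|³ = t²|s|, so the n cubic errors still sum to O(|s|).
    have h3 : |t / √(n : ℝ)| ^ 3 = t ^ 2 / n * |t / √(n : ℝ)| := by
      rw [← hsqn, ← sq_abs (t / √(n : ℝ))]
      ring
    rw [h3]
    field_simp
  have hlim : Tendsto (fun n : ℕ => (C * t ^ 2 + 2 * (‖ψ‖ + ‖b‖)) * |t / √(n : ℝ)|) atTop
      (nhds 0) := by
    simpa using hs.abs.const_mul (C * t ^ 2 + 2 * (‖ψ‖ + ‖b‖))
  have hdiff := squeeze_zero_norm' hbound hlim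
  simpa using hdiff.add hpow

end CharFun

/-! ### The central limit theorem -/

theorem proposition2 (α : ℝ) (hα : Irrational α)
    (φ : UnitAddCircle → ℝ) (hφ : IsTrigPolynomial φ)
    (hφ_nonconst : ¬ ∃ c : ℝ, ∀ x, φ x = c) (hφ_mean : ∫ x, φ x = 0) :
    ∃ σ : ℝ, 0 < σ ∧
      ∀ (Ω : Type*) [MeasurableSpace Ω] (P : Measure Ω) [IsProbabilityMeasure P]
        (Y : ℕ → Ω → UnitAddCircle), IsMarkovChain (rotationKernel α) volume P Y →
        TendstoInDistribution
          (fun (n : ℕ) ω => (∑ k ∈ Finset.range n, φ (Y k ω)) / √(n : ℝ)) atTop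
          (id : ℝ → ℝ) (fun _ => P) (gaussianReal 0 (σ ^ 2).toNNReal) := by
  obtain ⟨Φ, hΦ, rfl⟩ := hφ.exists_complexify
  obtain ⟨ψ, hψA, hψ⟩ := exists_real_sub_rotationAverage_eq hα hΦ hφ_mean
  set v : ℝ := ∫ x, (ψ x ^ 2 - (ψ x - Φ x) ^ 2) with hv
  have hvpos : 0 < v := integral_sq_sub_sq_pos hα hφ_nonconst hψ
  -- The right-hand side is a trigonometric polynomial because these form an algebra. The factor
  -- -1/2 gives it mean -v/2, and subtracting this mean produces the term v/2.
  obtain ⟨b, -, hb⟩ := exists_sub_rotationAverage_eq hα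
    (f := (-2⁻¹ : ℂ) • (complexify ψ ^ 2 - (complexify ψ - complexify Φ) ^ 2))
    (SMulMemClass.smul_mem _ (sub_mem (pow_mem hψA 2) (pow_mem (sub_mem hψA hΦ) 2)))
  have hb' (x : UnitAddCircle) : b x - rotationAverage α b x =
      ((v - (ψ x ^ 2 - (ψ x - Φ x) ^ 2) : ℝ) : ℂ) / 2 := by
    have hvc : (v : ℂ) = ∫ x, ((ψ x : ℂ) ^ 2 - ((ψ x : ℂ) - Φ x) ^ 2) := by
      rw [hv, ← integral_complex_ofReal]
      push_cast
      rfl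
    rw [hb x]
    simp only [ContinuousMap.smul_apply, ContinuousMap.sub_apply, ContinuousMap.pow_apply,
      complexify_apply, smul_eq_mul]
    rw [integral_const_mul, ← hvc]
    push_cast
    ring
  refine ⟨√v, Real.sqrt_pos.2 hvpos, fun Ω _ P _ Y hY => ?_⟩
  have hm (n : ℕ) : Measurable fun ω => (∑ k ∈ Finset.range n, Φ (Y k ω)) / √(n : ℝ) :=
    (Finset.measurable_fun_sum _ fun k _ =>
      Φ.continuous.measurable.comp (hY.measurable k)).div_const _
  refine ⟨fun n => (hm n).aemeasurable, aemeasurable_id, ?_⟩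
  refine ProbabilityMeasure.tendsto_iff_tendsto_charFun.2 fun t => ?_
  have hlim := hY.tendsto_integral_exp_sum_div_sqrt hvpos hψ hb' t
  simp only [ProbabilityMeasure.coe_mk, Measure.map_id]
  rw [charFun_gaussianReal, Real.sq_sqrt hvpos.le, Real.coe_toNNReal v hvpos.le]
  convert hlim using 2 with n
  · rw [charFun_apply_real, integral_map (hm n).aemeasurable (by fun_prop)]
    congr 1
    ext ω
    push_cast
    ring_nf
  · simp
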